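/- Let $S$ be the set of positive rational numbers $a$ for which there exist positive rational initial conditions $x_0,x_1$ such that the sequence $(x_n)_{n\ge 0}$ generated by the Lyness recurrence $x_{n+2}=(a+x_{n+1})/x_n$ is $9$-periodic, in the sense that its least positive period is $9$. Then $S$ is infinite. Furthermore, the closure of $S$ in $\mathbb{R}$ contains the interval $[a_1,+\infty)$, where $a_1\simeq 5.41147624$ is the largest real root of $a^3-\frac{2019}{529}a^2-\frac{777}{92}a-1$. -/

import Mathlib

/-- The sequence generated by the Lyness recurrence `x (n + 2) = (a + x (n + 1)) / x n` with
initial conditions `x 0 = x₀` and `x 1 = x₁`. For `a, x₀, x₁ > 0` all terms are positive, so no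
division by zero ever takes place. -/
def lynessSeq (a x₀ x₁ : ℚ) : ℕ → ℚ
  | 0 => x₀
  | 1 => x₁
  | n + 2 => (a + lynessSeq a x₀ x₁ (n + 1)) / lynessSeq a x₀ x₁ n

/-- The sequence `x` is `p`-periodic, in the sense of prime period: `p` is its least positive
period. -/
def HasPrimePeriod (x : ℕ → ℚ) (p : ℕ) : Prop :=
  IsLeast {q : ℕ | 0 < q ∧ Function.Periodic x q} p

/-- The positive rational parameters `a` for which some positive rational initial conditions
generate a Lyness sequence of prime period `9`. -/
def lynessNinePeriodicParams : Set ℚ :=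
  {a | 0 < a ∧ ∃ x₀ x₁ : ℚ, 0 < x₀ ∧ 0 < x₁ ∧ HasPrimePeriod (lynessSeq a x₀ x₁) 9}

/-! Write `uₙ(x₀, x₁)` for the terms of the sequence. The recurrence also runs backwards, so the
sequence has period `9` as soon as `u₅(x₀, x₁) = u₅(x₁, x₀)` and `u₆(x₀, x₁) = u₄(x₁, x₀)`; both
follow from one polynomial condition, symmetric in `x₀, x₁`. Under this condition, period `3` would
make `x₀ = x₁` a rational root of a cubic that has none. On the slice `x₀ + x₁ = 23 / 4` the
condition determines `x₀ * x₁` as a rational function of `a`, and `x₀, x₁` are rational exactly when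
`a = 4 - 7488 / X` for a rational point `(X, Y)` of a fixed elliptic curve `E`. It remains to find
many rational points of `E` with `X < 0`.

A rational point whose abscissa is not `2`-adically integral generates infinitely many: doubling it
strictly increases the `2`-adic absolute value of the abscissa. Infinitely many points of `E(ℝ)` in
a subgroup have unbounded abscissas: if they were bounded, they would accumulate, and the bound on
the abscissas of sums would make the accumulation point singular. Finally, adding a point that is
far out moves a given point by a small amount to the left, so the abscissas of the subgroup are
dense in every interval to the left of one of them on which the cubic is positive. -/

section Lyness

variable {a x y : ℚ}

lemma lynessSeq_add_two (a x y : ℚ) (n : ℕ) :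
    lynessSeq a x y (n + 2) = (a + lynessSeq a x y (n + 1)) / lynessSeq a x y n := by
  rw [lynessSeq]

lemma lynessSeq_pos (ha : 0 < a) (hx : 0 < x) (hy : 0 < y) : ∀ n, 0 < lynessSeq a x y n
  | 0 => by rwa [lynessSeq]
  | 1 => by rwa [lynessSeq]
  | n + 2 => by
    rw [lynessSeq_add_two]
    exact div_pos (add_pos ha (lynessSeq_pos ha hx hy (n + 1))) (lynessSeq_pos ha hx hy n)

lemma lynessSeq_mul (ha : 0 < a) (hx : 0 < x) (hy : 0 < y) (n : ℕ) :
    lynessSeq a x y (n + 2) * lynessSeq a x y n = a + lynessSeq a x y (n + 1) := by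
  rw [lynessSeq_add_two, div_mul_cancel₀ _ (lynessSeq_pos ha hx hy n).ne']

lemma lynessSeq_periodic_of_eq {p : ℕ} (h0 : lynessSeq a x y p = x)
    (h1 : lynessSeq a x y (p + 1) = y) : Function.Periodic (lynessSeq a x y) p := by
  intro n
  induction n using Nat.twoStepInduction with
  | zero => rw [zero_add, h0, lynessSeq]
  | one => rw [add_comm, h1, lynessSeq]
  | more n ih₀ ih₁ =>
    rw [lynessSeq_add_two, ← ih₀, ← ih₁, add_right_comm n 2 p, lynessSeq_add_two,
      add_right_comm n 1 p]

lemma lynessSeq_add_eq_swap_of_add_eq (ha : 0 < a) (hx : 0 < x) (hy : 0 < y) {k m : ℕ}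
    (h0 : lynessSeq a x y k = lynessSeq a y x (m + 1))
    (h1 : lynessSeq a x y (k + 1) = lynessSeq a y x m) {i j : ℕ} (hij : i + j = m) :
    lynessSeq a x y (k + i) = lynessSeq a y x (j + 1) ∧
      lynessSeq a x y (k + i + 1) = lynessSeq a y x j := by
  induction i generalizing j with
  | zero =>
    obtain rfl : j = m := by omega
    exact ⟨h0, h1⟩
  | succ i ih =>
    obtain ⟨ih₀, ih₁⟩ := ih (j := j + 1) (by omega)
    refine ⟨ih₁, ?_⟩
    change lynessSeq a x y (k + i + 2) = _
    rw [lynessSeq_add_two, ih₀, ih₁, div_eq_iff (lynessSeq_pos ha hy hx _).ne', mul_comm,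
      lynessSeq_mul ha hy hx]

lemma lynessSeq_two_three_four (hx : x ≠ 0) (hy : y ≠ 0) (hay : a + y ≠ 0) :
    lynessSeq a x y 2 = (a + y) / x ∧ lynessSeq a x y 3 = (a * x + a + y) / (x * y) ∧
      lynessSeq a x y 4 = (a * x * y + a * x + a + y) / (y * (a + y)) := by
  have u0 : lynessSeq a x y 0 = x := by rw [lynessSeq]
  have u1 : lynessSeq a x y 1 = y := by rw [lynessSeq]
  have u2 : lynessSeq a x y 2 = (a + y) / x := by rw [lynessSeq_add_two, u0, u1]
  have u3 : lynessSeq a x y 3 = (a * x + a + y) / (x * y) := by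
    rw [lynessSeq_add_two, u1, u2]; field_simp; ring
  refine ⟨u2, u3, ?_⟩
  rw [lynessSeq_add_two, u2, u3]; field_simp; ring

lemma lynessSeq_periodic_nine (ha : 0 < a) (hx : 0 < x) (hy : 0 < y)
    (h : a * (x + 1) * (y + 1) * (x + y + a) = (a - 1) * (a ^ 2 - a + 1) * (x * y)) :
    Function.Periodic (lynessSeq a x y) 9 := by
  obtain ⟨-, u3, u4⟩ := lynessSeq_two_three_four hx.ne' hy.ne' (add_pos ha hy).ne'
  obtain ⟨-, v3, v4⟩ := lynessSeq_two_three_four hy.ne' hx.ne' (add_pos ha hx).ne'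
  have u5 : lynessSeq a x y 5 = (a + lynessSeq a x y 4) / lynessSeq a x y 3 :=
    lynessSeq_add_two a x y 3
  have v5 : lynessSeq a y x 5 = (a + lynessSeq a y x 4) / lynessSeq a y x 3 :=
    lynessSeq_add_two a y x 3
  have hmid : lynessSeq a x y 5 = lynessSeq a y x 5 := by
    rw [u5, v5, u3, u4, v3, v4]
    have : 0 < a * x + a + y := by positivity
    have : 0 < a * y + a + x := by positivity
    field_simp
    linear_combination (x - y) * (a + x + y) * h
  have hnext : lynessSeq a x y 6 = lynessSeq a y x 4 := by
    rw [lynessSeq_add_two, hmid, div_eq_iff (lynessSeq_pos ha hx hy 4).ne', v5, u4, v3, v4]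
    have : 0 < a * y + a + x := by positivity
    field_simp
    linear_combination -(a * y + a - y ^ 2 * x + x) * h
  obtain ⟨h9, h10⟩ := lynessSeq_add_eq_swap_of_add_eq ha hx hy hmid hnext (add_zero 4)
  exact lynessSeq_periodic_of_eq (h9.trans (by rw [lynessSeq])) (h10.trans (by rw [lynessSeq]))

end Lyness

lemma eq_of_lynessSeq_periodic_three {a x y : ℚ} (ha : 0 < a) (hx : 0 < x) (hy : 0 < y)
    (h : Function.Periodic (lynessSeq a x y) 3) : x = y ∧ x ^ 2 = a + x := by
  have u0 : lynessSeq a x y 0 = x := by rw [lynessSeq]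
  have u1 : lynessSeq a x y 1 = y := by rw [lynessSeq]
  have u3 : lynessSeq a x y 3 = x := (h 0).trans u0
  have u4 : lynessSeq a x y 4 = y := (h 1).trans u1
  obtain ⟨z, hz⟩ : ∃ z, lynessSeq a x y 2 = z := ⟨_, rfl⟩
  have hzx : z * x = a + y := by simpa [u0, u1, hz] using lynessSeq_mul ha hx hy 0
  have hxy : x * y = a + z := by simpa [u1, hz, u3] using lynessSeq_mul ha hx hy 1
  have hyz : y * z = a + x := by simpa [hz, u3, u4] using lynessSeq_mul ha hx hy 2
  have hzy : z = y :=
    mul_left_cancel₀ (by positivity : x + 1 ≠ 0) (by linear_combination hzx - hxy)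
  have hxy' : x = y := by
    refine mul_left_cancel₀ (by positivity : y + 1 ≠ 0) ?_
    linear_combination hxy - hyz + (y + 1) * hzy
  subst hzy hxy'
  exact ⟨rfl, by linear_combination hxy⟩

lemma hasPrimePeriod_prime_pow {u : ℕ → ℚ} {p k : ℕ} (hp : p.Prime)
    (h : Function.Periodic u (p ^ (k + 1))) (hk : ¬Function.Periodic u (p ^ k)) :
    HasPrimePeriod u (p ^ (k + 1)) := by
  let shift : (ℕ → ℚ) → ℕ → ℚ := fun v n => v (n + 1)
  have shift_iterate (q : ℕ) (v : ℕ → ℚ) : shift^[q] v = fun n => v (n + q) := by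
    induction q generalizing v with
    | zero => rfl
    | succ q ih => rw [Function.iterate_succ_apply, ih]; rfl
  have periodic_iff (q : ℕ) : Function.Periodic u q ↔ Function.IsPeriodicPt shift q u := by
    rw [Function.IsPeriodicPt, Function.IsFixedPt, shift_iterate, funext_iff]
    rfl
  have : Fact p.Prime := ⟨hp⟩
  refine ⟨⟨pow_pos hp.pos _, h⟩, fun q ⟨hq, hper⟩ => ?_⟩
  rw [periodic_iff] at h hk hper
  rw [← Function.minimalPeriod_eq_prime_pow hk h]
  exact hper.minimalPeriod_le hq

lemma rat_cube_sub_three_mul_sq_add_one_ne_zero (x : ℚ) : x ^ 3 - 3 * x ^ 2 + 1 ≠ 0 := by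
  intro h
  have hint : IsIntegral ℤ x := by
    refine ⟨Polynomial.X ^ 3 - 3 * Polynomial.X ^ 2 + 1, by monicity!, ?_⟩
    simpa [Polynomial.eval₂_eq_eval_map] using h
  obtain ⟨n, rfl⟩ := IsIntegrallyClosed.isIntegral_iff.1 hint
  have hn : n * (n * (3 - n)) = 1 := by
    have : (n : ℚ) ^ 3 - 3 * n ^ 2 + 1 = 0 := h
    have : n ^ 3 - 3 * n ^ 2 + 1 = 0 := by exact_mod_cast this
    linear_combination -this
  rcases Int.eq_one_or_neg_one_of_mul_eq_one hn with rfl | rfl <;> norm_num at hn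

lemma hasPrimePeriod_nine_lynessSeq {a x y : ℚ} (ha : 0 < a) (hx : 0 < x) (hy : 0 < y)
    (h : a * (x + 1) * (y + 1) * (x + y + a) = (a - 1) * (a ^ 2 - a + 1) * (x * y)) :
    HasPrimePeriod (lynessSeq a x y) 9 := by
  refine hasPrimePeriod_prime_pow (p := 3) (k := 1) Nat.prime_three
    (lynessSeq_periodic_nine ha hx hy h) fun h3 => ?_
  obtain ⟨rfl, hfix⟩ := eq_of_lynessSeq_periodic_three ha hx hy h3
  obtain rfl : a = x ^ 2 - x := by linear_combination -hfix
  refine rat_cube_sub_three_mul_sq_add_one_ne_zero x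
    (mul_left_cancel₀ (pow_ne_zero 5 hx.ne') ?_)
  linear_combination -h

-- For `x + y = s`, the condition for period `9` is linear in `x * y`, and `s = 23 / 4` gives the
-- coefficient of `x * y` a double root, which lowers the genus of the resulting curve from `2` to
-- `1`.
lemma mem_lynessNinePeriodicParams {a x y : ℚ} (ha : 4 < a) (hsum : x + y = 23 / 4)
    (hprod : (a - 4) * (2 * a + 1) ^ 2 * (x * y) = 27 * a * (a + 23 / 4)) :
    a ∈ lynessNinePeriodicParams := by
  have ha0 : 0 < a := by linarith
  have hxy : 0 < x * y := by
    have hcoeff : 0 < (a - 4) * (2 * a + 1) ^ 2 := mul_pos (by linarith) (by positivity)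
    refine pos_of_mul_pos_right ?_ hcoeff.le
    rw [hprod]
    positivity
  have hx : 0 < x := by nlinarith
  have hy : 0 < y := pos_of_mul_pos_right hxy hx.le
  refine ⟨ha0, x, y, hx, hy, hasPrimePeriod_nine_lynessSeq ha0 hx hy ?_⟩
  obtain rfl : y = 23 / 4 - x := by linear_combination hsum
  linear_combination -hprod / 4

open WeierstrassCurve.Affine (Point)

/-- The cubic `f` in the equation `y² = f(x)` of a Weierstrass curve with `a₁ = a₃ = 0`. -/
def weierstrassCubic {K : Type*} [Field K] (W : WeierstrassCurve.Affine K) (x : K) : K :=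
  x ^ 3 + W.a₂ * x ^ 2 + W.a₄ * x + W.a₆

section Cubic

variable {K : Type*} [Field K] {W : WeierstrassCurve.Affine K} [W.IsCharNeTwoNF]

lemma equation_iff_sq_eq_weierstrassCubic {x y : K} :
    W.Equation x y ↔ y ^ 2 = weierstrassCubic W x := by
  simp [WeierstrassCurve.Affine.equation_iff, weierstrassCubic]

lemma exists_nonsingular_duplication (h2 : (2 : K) ≠ 0) {x y : K} (h : W.Nonsingular x y)
    (hy : y ≠ 0) : ∃ x' y', W.Nonsingular x' y' ∧ 4 * weierstrassCubic W x * x' =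
      x ^ 4 + (-(2 * W.a₄) * x ^ 2 + -(8 * W.a₆) * x + (W.a₄ ^ 2 - 4 * W.a₂ * W.a₆)) := by
  classical
  have hneg : y - W.negY x y = 2 * y := by
    simp only [WeierstrassCurve.Affine.negY, WeierstrassCurve.a₁_of_isCharNeTwoNF,
      WeierstrassCurve.a₃_of_isCharNeTwoNF]
    ring
  have hy' : y ≠ W.negY x y := sub_ne_zero.1 (hneg ▸ mul_ne_zero h2 hy)
  refine ⟨_, _, WeierstrassCurve.Affine.nonsingular_add h h fun hxy => hy' hxy.2, ?_⟩
  have hslope : W.slope x x y y * (2 * y) = 3 * x ^ 2 + 2 * W.a₂ * x + W.a₄ := by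
    rw [WeierstrassCurve.Affine.slope_of_Y_ne rfl hy', hneg, div_mul_cancel₀ _ (mul_ne_zero h2 hy),
      WeierstrassCurve.a₁_of_isCharNeTwoNF, zero_mul, sub_zero]
  have hf := equation_iff_sq_eq_weierstrassCubic.1 h.1
  rw [weierstrassCubic] at hf ⊢
  rw [WeierstrassCurve.Affine.addX, WeierstrassCurve.a₁_of_isCharNeTwoNF]
  linear_combination (W.slope x x y y * (2 * y) + 3 * x ^ 2 + 2 * W.a₂ * x + W.a₄) * hslope -
    4 * (W.slope x x y y ^ 2) * hf

end Cubic

section Valuation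

variable {Γ₀ : Type*} [LinearOrderedCommGroupWithZero Γ₀]

lemma valuation_quadratic_le {R : Type*} [Ring R] {v : Valuation R Γ₀} {a b c x : R}
    (ha : a ∈ v.integer) (hb : b ∈ v.integer) (hc : c ∈ v.integer) (hx : 1 ≤ v x) :
    v (a * x ^ 2 + b * x + c) ≤ v x ^ 2 := by
  have hx2 : v x ≤ v x ^ 2 := le_self_pow hx two_ne_zero
  refine v.map_add_le (v.map_add_le ?_ ?_) (hc.trans (hx.trans hx2))
  · rw [map_mul, map_pow]
    exact mul_le_of_le_one_left' ha
  · rw [map_mul]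
    exact (mul_le_of_le_one_left' hb).trans hx2

lemma valuation_pow_add_of_le_sq {R : Type*} [Ring R] {v : Valuation R Γ₀} {x z : R} {n : ℕ}
    (hn : 2 < n) (hx : 1 < v x) (hz : v z ≤ v x ^ 2) : v (x ^ n + z) = v x ^ n := by
  rw [← map_pow]
  refine v.map_add_eq_of_lt_left (hz.trans_lt ?_)
  rw [map_pow]
  exact pow_lt_pow_right₀ hx hn

variable {K : Type*} [Field K] {v : Valuation K Γ₀} {W : WeierstrassCurve.Affine K}
  [W.IsCharNeTwoNF]

lemma exists_nonsingular_valuation_lt (h2 : (2 : K) ≠ 0) (hv2 : v 2 < 1)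
    (ha₂ : W.a₂ ∈ v.integer) (ha₄ : W.a₄ ∈ v.integer) (ha₆ : W.a₆ ∈ v.integer) {x y : K}
    (h : W.Nonsingular x y) (hx : 1 < v x) :
    ∃ x' y', W.Nonsingular x' y' ∧ v x < v x' := by
  have hx0 : 0 < v x := zero_lt_one.trans hx
  have hcubic : v (weierstrassCubic W x) = v x ^ 3 := by
    rw [weierstrassCubic, add_assoc, add_assoc, ← add_assoc (W.a₂ * x ^ 2)]
    exact valuation_pow_add_of_le_sq (by norm_num) hx (valuation_quadratic_le ha₂ ha₄ ha₆ hx.le)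
  have hy : y ≠ 0 := by
    rintro rfl
    have hzero : weierstrassCubic W x = 0 := by
      rw [← equation_iff_sq_eq_weierstrassCubic.1 h.1, zero_pow two_ne_zero]
    rw [hzero, map_zero] at hcubic
    exact (pow_pos hx0 3).ne hcubic
  obtain ⟨x', y', h', hdup⟩ := exists_nonsingular_duplication h2 h hy
  refine ⟨x', y', h', ?_⟩
  have hint (n : ℕ) : (n : K) ∈ v.integer := natCast_mem v.integer n
  have hv : v 4 * v x ^ 3 * v x' = v x ^ 4 := by
    rw [← hcubic, ← map_mul, ← map_mul, hdup]
    refine valuation_pow_add_of_le_sq (by norm_num) hx (valuation_quadratic_le ?_ ?_ ?_ hx.le)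
    · exact neg_mem (mul_mem (hint 2) ha₄)
    · exact neg_mem (mul_mem (hint 8) ha₆)
    · exact sub_mem (pow_mem ha₄ 2) (mul_mem (mul_mem (hint 4) ha₂) ha₆)
  have hv4 : v 4 < 1 := by
    rw [show (4 : K) = 2 ^ 2 by norm_num, map_pow]
    exact pow_lt_one' hv2 two_ne_zero
  have hv' : v 4 * v x' = v x := by
    refine mul_right_cancel₀ (pow_pos hx0 3).ne' ?_
    rw [mul_right_comm, hv, pow_succ']
  have hx' : 0 < v x' := by
    refine zero_lt_iff.2 fun hx' => hx0.ne ?_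
    rw [← hv', hx', mul_zero]
  calc v x = v 4 * v x' := hv'.symm
    _ < 1 * v x' := mul_lt_mul_of_pos_right hv4 hx'
    _ = v x' := one_mul _

lemma infinite_point_of_one_lt_valuation (h2 : (2 : K) ≠ 0) (hv2 : v 2 < 1)
    (ha₂ : W.a₂ ∈ v.integer) (ha₄ : W.a₄ ∈ v.integer) (ha₆ : W.a₆ ∈ v.integer) {x y : K}
    (h : W.Nonsingular x y) (hx : 1 < v x) : Infinite W.Point := by
  by_contra hfin
  rw [not_infinite_iff_finite] at hfin
  let val (P : W.Point) : Γ₀ := v (P.xRep 0)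
  obtain ⟨P, hP⟩ := Finite.exists_max val
  have hP1 : 1 < val P := hx.trans_le (hP (.some x y h))
  rcases P with _ | ⟨x', y', h'⟩
  · exact hP1.ne (by simp [val, ← Point.zero_def])
  · obtain ⟨x₂, y₂, h₂, hlt⟩ :=
      exists_nonsingular_valuation_lt h2 hv2 ha₂ ha₄ ha₆ h' hP1
    exact (hP (.some x₂ y₂ h₂)).not_gt hlt

end Valuation

section AffineCoords

variable {K : Type*} [Field K] {W : WeierstrassCurve.Affine K}

/-- The abscissas of the affine points of a set of points of a Weierstrass curve. -/
def xCoords (G : Set W.Point) : Set K :=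
  {x | ∃ y h, Point.some x y h ∈ G}

lemma infinite_xCoords {G : Set W.Point} (hG : G.Infinite) : (xCoords G).Infinite := by
  intro hfin
  have hfibre (u : Fin 2 → K) : (G ∩ Point.xRep ⁻¹' {u}).Finite := by
    rcases (G ∩ Point.xRep ⁻¹' {u}).eq_empty_or_nonempty with hu | ⟨P, -, hP⟩
    · exact hu ▸ Set.finite_empty
    · refine (Set.toFinite {P, -P}).subset fun Q ⟨_, hQ⟩ => ?_
      exact Point.eq_or_eq_neg_of_xRep_eq_xRep (hQ.trans hP.symm)
  refine hG (Set.Finite.of_finite_fibers Point.xRep ?_ fun u _ => hfibre u)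
  refine ((hfin.image fun x => ![x, 1]).insert ![1, 0]).subset ?_
  rintro _ ⟨_ | ⟨x, y, h⟩, hP, rfl⟩
  · exact .inl Point.xRep_zero
  · exact .inr ⟨x, ⟨y, h, hP⟩, (Point.xRep_some h).symm⟩

variable [W.IsCharNeTwoNF] [DecidableEq K] {G : AddSubgroup W.Point} {x y x₁ y₁ x₂ y₂ : K}

lemma exists_some_neg_mem {h : W.Nonsingular x y} (hP : Point.some x y h ∈ G) :
    ∃ h', Point.some x (-y) h' ∈ G := by
  have hneg := neg_mem hP
  rw [Point.neg_some] at hneg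
  have : W.negY x y = -y := by simp [WeierstrassCurve.Affine.negY]
  simp only [this] at hneg
  exact ⟨_, hneg⟩

lemma div_sq_sub_mem_xCoords {h₁ : W.Nonsingular x₁ y₁} {h₂ : W.Nonsingular x₂ y₂}
    (hP : Point.some x₁ y₁ h₁ ∈ G) (hQ : Point.some x₂ y₂ h₂ ∈ G) (hx : x₁ ≠ x₂) :
    ((y₁ - y₂) / (x₁ - x₂)) ^ 2 - W.a₂ - x₁ - x₂ ∈ xCoords (G : Set W.Point) := by
  have hsum : W.addX x₁ x₂ (W.slope x₁ x₂ y₁ y₂) =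
      ((y₁ - y₂) / (x₁ - x₂)) ^ 2 - W.a₂ - x₁ - x₂ := by
    simp [WeierstrassCurve.Affine.addX, WeierstrassCurve.Affine.slope_of_X_ne hx]
  have hadd := add_mem hP hQ
  rw [Point.add_of_X_ne hx] at hadd
  exact hsum ▸ ⟨_, _, hadd⟩

end AffineCoords

section Real

open Filter Topology

lemma eq_zero_and_deriv_eq_zero_of_accPt {f : ℝ → ℝ} {f' p C : ℝ} {s : Set ℝ}
    (hf : HasDerivAt f f' p) (hp : AccPt p (𝓟 s))
    (hs : ∀ x ∈ s, ∀ y ∈ s, x ≠ y → |f x| ≤ C * (x - y) ^ 2) : f p = 0 ∧ f' = 0 := by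
  have : (𝓝[s \ {p}] p).NeBot := accPt_principal_iff_nhdsWithin.1 hp
  have hid : Tendsto id (𝓝[s \ {p}] p) (𝓝 p) := tendsto_id.mono_left nhdsWithin_le_nhds
  have hbound : ∀ x ∈ s \ {p}, |f x| ≤ C * (x - p) ^ 2 := fun x hx => by
    refine ge_of_tendsto (((tendsto_const_nhds.sub hid).pow 2).const_mul C) ?_
    filter_upwards [self_mem_nhdsWithin, hid.eventually_ne (Ne.symm hx.2)] with y hy hyx
    exact hs x hx.1 y hy.1 hyx.symm
  have hev : ∀ᶠ x in 𝓝[s \ {p}] p, |f x| ≤ C * (x - p) ^ 2 :=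
    eventually_mem_nhdsWithin.mono hbound
  have hp0 : f p = 0 := by
    have hlim := ((hid.sub_const p).pow 2).const_mul C
    refine tendsto_nhds_unique (hf.continuousAt.tendsto.comp hid) (squeeze_zero_norm' hev ?_)
    simpa using hlim
  have hslope : Tendsto (slope f p) (𝓝[s \ {p}] p) (𝓝 f') :=
    hasDerivWithinAt_iff_tendsto_slope.1 hf.hasDerivWithinAt
  refine ⟨hp0, tendsto_nhds_unique hslope
    (squeeze_zero_norm' (a := fun x => C * |x - p|) ?_ ?_)⟩
  · filter_upwards [hev, self_mem_nhdsWithin] with x hx hxp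
    have hpos : 0 < |x - p| := abs_pos.2 (sub_ne_zero.2 hxp.2)
    rw [slope_def_field, hp0, sub_zero, Real.norm_eq_abs, abs_div, div_le_iff₀ hpos, mul_assoc,
      abs_mul_abs_self, ← sq]
    exact hx
  · simpa using ((hid.sub_const p).abs).const_mul C

lemma tendsto_weierstrassCubic_div_cube {K : Type*} [NormedField K]
    (W : WeierstrassCurve.Affine K) :
    Tendsto (fun x => weierstrassCubic W x / x ^ 3) (Bornology.cobounded K) (𝓝 1) := by
  have hinv : Tendsto (fun x : K => x⁻¹) (Bornology.cobounded K) (𝓝 0) := tendsto_inv₀_cobounded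
  have hlim : Tendsto (fun x : K => 1 + W.a₂ * x⁻¹ + W.a₄ * x⁻¹ ^ 2 + W.a₆ * x⁻¹ ^ 3)
      (Bornology.cobounded K) (𝓝 1) := by
    simpa using ((tendsto_const_nhds.add (hinv.const_mul W.a₂)).add
      ((hinv.pow 2).const_mul W.a₄)).add ((hinv.pow 3).const_mul W.a₆)
  refine hlim.congr' ?_
  filter_upwards [Bornology.eventually_ne_cobounded (0 : K)] with x hx
  rw [weierstrassCubic]
  field_simp

lemma hasDerivAt_weierstrassCubic {K : Type*} [NontriviallyNormedField K]
    (W : WeierstrassCurve.Affine K) (x : K) :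
    HasDerivAt (weierstrassCubic W) (3 * x ^ 2 + 2 * W.a₂ * x + W.a₄) x := by
  refine ((((hasDerivAt_pow 3 x).add ((hasDerivAt_pow 2 x).const_mul W.a₂)).add
    ((hasDerivAt_id x).const_mul W.a₄)).add_const W.a₆).congr_deriv ?_
  push_cast
  ring

variable {W : WeierstrassCurve.Affine ℝ}

lemma exists_weierstrassCubic_neg_of_le (W : WeierstrassCurve.Affine ℝ) :
    ∃ m, ∀ x ≤ m, weierstrassCubic W x < 0 := by
  rw [← eventually_atBot]
  have hlim := (tendsto_weierstrassCubic_div_cube W).mono_left IsOrderBornology.atBot_le_cobounded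
  filter_upwards [hlim.eventually_const_lt zero_lt_one, eventually_lt_atBot 0] with x hx hx0
  have hcube : x ^ 3 < 0 := Odd.pow_neg (by decide) hx0
  exact (div_pos_iff.1 hx).resolve_left (fun h => h.2.not_gt hcube) |>.1

variable [W.IsCharNeTwoNF]

lemma weierstrassCubic_nonneg_of_mem_xCoords {G : Set W.Point} {x : ℝ} (hx : x ∈ xCoords G) :
    0 ≤ weierstrassCubic W x := by
  obtain ⟨y, h, -⟩ := hx
  rw [← equation_iff_sq_eq_weierstrassCubic.1 h.1]
  positivity

variable {G : AddSubgroup W.Point} {x : ℝ}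

lemma exists_some_sqrt_mem (hx : x ∈ xCoords (G : Set W.Point)) :
    ∃ h, Point.some x √(weierstrassCubic W x) h ∈ G := by
  obtain ⟨y, h, hP⟩ := hx
  rw [← equation_iff_sq_eq_weierstrassCubic.1 h.1, Real.sqrt_sq_eq_abs]
  rcases abs_choice y with hy | hy <;> rw [hy]
  · exact ⟨h, hP⟩
  · exact exists_some_neg_mem hP

lemma weierstrassCubic_le_of_mem_upperBounds {M x' : ℝ}
    (hM : M ∈ upperBounds (xCoords (G : Set W.Point))) (hx : x ∈ xCoords (G : Set W.Point))
    (hx' : x' ∈ xCoords (G : Set W.Point)) (hne : x ≠ x') :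
    weierstrassCubic W x ≤ (3 * M + W.a₂) * (x - x') ^ 2 := by
  obtain ⟨h, hP⟩ := exists_some_sqrt_mem hx
  obtain ⟨h', hQ⟩ := exists_some_sqrt_mem hx'
  obtain ⟨_, hQneg⟩ := exists_some_neg_mem hQ
  have hsum := hM (div_sq_sub_mem_xCoords hP hQneg hne)
  have hdiv : ((√(weierstrassCubic W x) + √(weierstrassCubic W x')) / (x - x')) ^ 2 ≤
      3 * M + W.a₂ := by
    rw [sub_neg_eq_add] at hsum
    linarith [hM hx, hM hx']
  rw [div_pow, div_le_iff₀ (sq_pos_of_ne_zero (sub_ne_zero.2 hne))] at hdiv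
  calc weierstrassCubic W x = √(weierstrassCubic W x) ^ 2 :=
        (Real.sq_sqrt (weierstrassCubic_nonneg_of_mem_xCoords hx)).symm
    _ ≤ (√(weierstrassCubic W x) + √(weierstrassCubic W x')) ^ 2 := by
        gcongr
        exact le_add_of_nonneg_right (Real.sqrt_nonneg _)
    _ ≤ (3 * M + W.a₂) * (x - x') ^ 2 := hdiv

lemma not_bddAbove_xCoords [W.IsElliptic] (hG : (G : Set W.Point).Infinite) :
    ¬BddAbove (xCoords (G : Set W.Point)) := by
  rintro ⟨M, hM⟩
  obtain ⟨m, hm⟩ := exists_weierstrassCubic_neg_of_le W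
  have hIcc : xCoords (G : Set W.Point) ⊆ Set.Icc m M := fun x hx => by
    refine ⟨le_of_not_ge fun hxm => ?_, hM hx⟩
    exact (weierstrassCubic_nonneg_of_mem_xCoords hx).not_gt (hm x hxm)
  obtain ⟨p, -, hp⟩ :=
    (infinite_xCoords hG).exists_accPt_of_subset_isCompact isCompact_Icc hIcc
  have hbound : ∀ x ∈ xCoords (G : Set W.Point), ∀ x' ∈ xCoords (G : Set W.Point), x ≠ x' →
      |weierstrassCubic W x| ≤ (3 * M + W.a₂) * (x - x') ^ 2 := fun x hx x' hx' hne => by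
    rw [abs_of_nonneg (weierstrassCubic_nonneg_of_mem_xCoords hx)]
    exact weierstrassCubic_le_of_mem_upperBounds hM hx hx' hne
  obtain ⟨hp0, hp1⟩ :=
    eq_zero_and_deriv_eq_zero_of_accPt (hasDerivAt_weierstrassCubic W p) hp hbound
  have heq : W.Equation p 0 := equation_iff_sq_eq_weierstrassCubic.2 (by rw [hp0]; norm_num)
  have hns := WeierstrassCurve.Affine.equation_iff_nonsingular.1 heq
  simp [WeierstrassCurve.Affine.nonsingular_iff, hp1] at hns

/-- The abscissa of the sum of the two points with abscissas `x ≠ x'` and nonnegative ordinates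
on the real curve `y² = f(x)`. -/
noncomputable def upperSumX (W : WeierstrassCurve.Affine ℝ) (x x' : ℝ) : ℝ :=
  ((√(weierstrassCubic W x) - √(weierstrassCubic W x')) / (x - x')) ^ 2 - W.a₂ - x - x'

section Asymptotics

variable {W : WeierstrassCurve.Affine ℝ} {x x' : ℝ}

lemma continuousAt_upperSumX (hne : x ≠ x') :
    ContinuousAt (fun z => upperSumX W z x') x := by
  have hcubic : Continuous (weierstrassCubic W) :=
    continuous_iff_continuousAt.2 fun z => (hasDerivAt_weierstrassCubic W z).continuousAt
  have := sub_ne_zero.2 hne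
  unfold upperSumX
  fun_prop (disch := assumption)

lemma sub_upperSumX_mul_sq (hx : 0 ≤ weierstrassCubic W x)
    (hx' : 0 ≤ weierstrassCubic W x') (hne : x ≠ x') :
    (x - upperSumX W x x') * (x - x') ^ 2 =
      2 * √(weierstrassCubic W x) * √(weierstrassCubic W x') -
        (3 * x ^ 2 + 2 * W.a₂ * x + W.a₄) * x' - (2 * W.a₆ + W.a₄ * x - x ^ 3) := by
  have hy := Real.sq_sqrt hx
  have hy' := Real.sq_sqrt hx'
  have := sub_ne_zero.2 hne
  rw [upperSumX]
  set y := √(weierstrassCubic W x)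
  set y' := √(weierstrassCubic W x')
  rw [weierstrassCubic] at hy hy'
  field_simp
  linear_combination - hy - hy'

lemma tendsto_sqrt_weierstrassCubic_div (W : WeierstrassCurve.Affine ℝ) :
    Tendsto (fun x => √(weierstrassCubic W x) / x) atTop atTop := by
  have hratio : Tendsto (fun x => weierstrassCubic W x / x ^ 3 * x) atTop atTop :=
    ((tendsto_weierstrassCubic_div_cube W).mono_left
      IsOrderBornology.atTop_le_cobounded).pos_mul_atTop one_pos tendsto_id
  refine (Real.tendsto_sqrt_atTop.comp hratio).congr' ?_
  filter_upwards [eventually_gt_atTop 0] with x hx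
  have hsq : weierstrassCubic W x / x ^ 3 * x = weierstrassCubic W x / x ^ 2 := by field_simp
  rw [Function.comp_apply, hsq, Real.sqrt_div' _ (sq_nonneg x), Real.sqrt_sq hx.le]

lemma tendsto_sqrt_weierstrassCubic_div_sq (W : WeierstrassCurve.Affine ℝ) :
    Tendsto (fun x => √(weierstrassCubic W x) / x ^ 2) atTop (𝓝 0) := by
  have hratio : Tendsto (fun x => weierstrassCubic W x / x ^ 3 / x) atTop (𝓝 0) :=
    ((tendsto_weierstrassCubic_div_cube W).mono_left
      IsOrderBornology.atTop_le_cobounded).div_atTop tendsto_id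
  have hsqrt := (Real.continuous_sqrt.tendsto 0).comp hratio
  rw [Real.sqrt_zero] at hsqrt
  refine hsqrt.congr fun x => ?_
  rw [Function.comp_apply, div_div, ← pow_succ, pow_mul x 2 2, Real.sqrt_div' _ (sq_nonneg _),
    Real.sqrt_sq (sq_nonneg x)]

lemma eventually_weierstrassCubic_pos (W : WeierstrassCurve.Affine ℝ) :
    ∀ᶠ x in atTop, 0 < weierstrassCubic W x := by
  filter_upwards [(tendsto_sqrt_weierstrassCubic_div W).eventually_gt_atTop 0,
    eventually_gt_atTop 0] with x hx hx0
  exact Real.sqrt_pos.1 ((div_pos_iff_of_pos_right hx0).1 hx)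

lemma tendsto_upperSumX (hx : 0 ≤ weierstrassCubic W x) :
    Tendsto (upperSumX W x) atTop (𝓝 x) := by
  have hconst_div (c : ℝ) (n : ℕ) (hn : n ≠ 0) : Tendsto (fun x' : ℝ => c / x' ^ n) atTop (𝓝 0) :=
    tendsto_const_nhds.div_atTop (tendsto_pow_atTop hn)
  have hnum : Tendsto (fun x' => 2 * √(weierstrassCubic W x) * (√(weierstrassCubic W x') / x' ^ 2)
      - (3 * x ^ 2 + 2 * W.a₂ * x + W.a₄) / x' ^ 1 - (2 * W.a₆ + W.a₄ * x - x ^ 3) / x' ^ 2)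
      atTop (𝓝 0) := by
    simpa using (((tendsto_sqrt_weierstrassCubic_div_sq W).const_mul _).sub
      (hconst_div _ 1 one_ne_zero)).sub (hconst_div _ 2 two_ne_zero)
  have hden : Tendsto (fun x' => (1 - x / x' ^ 1) ^ 2) atTop (𝓝 1) := by
    simpa using ((tendsto_const_nhds (x := (1 : ℝ))).sub (hconst_div x 1 one_ne_zero)).pow 2
  have hlim := (tendsto_const_nhds (x := x)).sub (hnum.div hden one_ne_zero)
  rw [zero_div, sub_zero] at hlim
  refine hlim.congr' ?_
  filter_upwards [eventually_gt_atTop 0, eventually_gt_atTop x,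
    eventually_weierstrassCubic_pos W] with x' hx' hxx' hcubic
  have := sub_ne_zero.2 hxx'.ne'
  have hkey := sub_upperSumX_mul_sq hx hcubic.le hxx'.ne
  rw [Pi.div_apply, sub_eq_iff_eq_add, ← sub_eq_iff_eq_add', eq_div_iff]
  · field_simp
    linear_combination hkey
  · rw [pow_one, one_sub_div hx'.ne']
    positivity

lemma eventually_upperSumX_lt (hx : 0 < weierstrassCubic W x) :
    ∀ᶠ x' in atTop, upperSumX W x x' < x := by
  have hlead : Tendsto (fun x' => 2 * √(weierstrassCubic W x) * (√(weierstrassCubic W x') / x'))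
      atTop atTop :=
    (tendsto_sqrt_weierstrassCubic_div W).const_mul_atTop (by positivity)
  have hrest : Tendsto (fun x' => (3 * x ^ 2 + 2 * W.a₂ * x + W.a₄) +
      (2 * W.a₆ + W.a₄ * x - x ^ 3) / x') atTop (𝓝 (3 * x ^ 2 + 2 * W.a₂ * x + W.a₄ + 0)) :=
    tendsto_const_nhds.add (tendsto_const_nhds.div_atTop tendsto_id)
  filter_upwards [(hlead.atTop_add hrest.neg).eventually_gt_atTop 0, eventually_gt_atTop 0,
    eventually_gt_atTop x, eventually_weierstrassCubic_pos W] with x' hpos hx' hxx' hcubic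
  have hkey := sub_upperSumX_mul_sq hx.le hcubic.le hxx'.ne
  have hprod : 0 < (x - upperSumX W x x') * (x - x') ^ 2 := by
    refine (mul_pos hpos hx').trans_eq ?_
    rw [hkey]
    field_simp
    ring
  exact sub_pos.1 (pos_of_mul_pos_left hprod (sq_nonneg _))

end Asymptotics

lemma upperSumX_mem_xCoords {x' : ℝ} (hx : x ∈ xCoords (G : Set W.Point))
    (hx' : x' ∈ xCoords (G : Set W.Point)) (hne : x ≠ x') :
    upperSumX W x x' ∈ xCoords (G : Set W.Point) := by
  obtain ⟨h, hP⟩ := exists_some_sqrt_mem hx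
  obtain ⟨h', hQ⟩ := exists_some_sqrt_mem hx'
  exact div_sq_sub_mem_xCoords hP hQ hne

lemma Icc_subset_closure_xCoords [W.IsElliptic] {t : ℝ} (hG : (G : Set W.Point).Infinite)
    (hx : x ∈ xCoords (G : Set W.Point)) (hpos : ∀ z ∈ Set.Icc t x, 0 < weierstrassCubic W z) :
    Set.Icc t x ⊆ closure (xCoords (G : Set W.Point)) := by
  refine IsClosed.Icc_subset_of_forall_exists_lt (isClosed_closure.inter isClosed_Icc)
    (subset_closure hx) fun z ⟨hz, htz⟩ u hu => ?_
  have hz0 := hpos z (Set.Ioc_subset_Icc_self htz)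
  have hev : ∀ᶠ x' in atTop, z < x' ∧ u < upperSumX W z x' ∧ upperSumX W z x' < z := by
    filter_upwards [eventually_gt_atTop z, eventually_upperSumX_lt hz0,
      (tendsto_upperSumX hz0.le).eventually_const_lt hu] with x' h₁ h₂ h₃
    exact ⟨h₁, h₃, h₂⟩
  obtain ⟨N, hN⟩ := eventually_atTop.1 hev
  obtain ⟨x', hx', hNx'⟩ := not_bddAbove_iff.1 (not_bddAbove_xCoords hG) N
  obtain ⟨hzx', hul, hlt⟩ := hN x' hNx'.le
  have hz' : z ∈ closure (Set.Iio x' ∩ xCoords (G : Set W.Point)) :=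
    isOpen_Iio.inter_closure ⟨hzx', hz⟩
  refine ⟨upperSumX W z x', ?_, hul.le, hlt⟩
  refine closure_mono ?_
    ((continuousAt_upperSumX hzx'.ne).continuousWithinAt.mem_closure_image hz')
  rintro _ ⟨w, ⟨hwx', hw⟩, rfl⟩
  exact upperSumX_mem_xCoords hw hx' (ne_of_lt hwx')

end Real

section Rational

open WeierstrassCurve.Affine

lemma xCoords_range_map {E : WeierstrassCurve ℤ} :
    xCoords (Set.range (Point.map (W' := E) (Algebra.ofId ℚ ℝ))) =
      ((↑) : ℚ → ℝ) '' xCoords (Set.univ : Set (E⁄ℚ).Point) := by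
  ext x
  constructor
  · rintro ⟨y, h, _ | ⟨x', y', h'⟩, hP⟩
    · cases hP
    · rw [Point.map_some] at hP
      injection hP with hx
      exact ⟨x', ⟨y', h', Set.mem_univ _⟩, hx⟩
  · rintro ⟨x, ⟨y, h, -⟩, rfl⟩
    exact ⟨_, _, .some x y h, Point.map_some _ h⟩

instance {R S : Type*} [CommRing R] [CommRing S] [Algebra R S] (W : WeierstrassCurve R)
    [W.IsCharNeTwoNF] : (W⁄S).IsCharNeTwoNF :=
  ⟨by simp, by simp⟩

lemma Icc_subset_closure_rat_xCoords {E : WeierstrassCurve ℤ} [E.IsCharNeTwoNF]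
    [(E⁄ℝ).IsElliptic] [Infinite (E⁄ℚ).Point] {t : ℝ} {q : ℚ}
    (hq : q ∈ xCoords (Set.univ : Set (E⁄ℚ).Point))
    (hpos : ∀ z ∈ Set.Icc t q, 0 < weierstrassCubic (E⁄ℝ) z) :
    Set.Icc t q ⊆ closure (((↑) : ℚ → ℝ) '' xCoords (Set.univ : Set (E⁄ℚ).Point)) := by
  rw [← xCoords_range_map, ← AddMonoidHom.coe_range]
  refine Icc_subset_closure_xCoords ?_ ?_ hpos
  · rw [AddMonoidHom.coe_range]
    exact Set.infinite_range_of_injective (Point.map_injective _)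
  · rw [AddMonoidHom.coe_range, xCoords_range_map]
    exact ⟨q, hq, rfl⟩

end Rational

section NinePeriodCurve

open scoped WeierstrassCurve.Affine

/-- The elliptic curve `E` that parametrises the positive `x, y` with `x + y = 23 / 4` that generate
a Lyness sequence of period `9`: a point `(X, Y)` of `E` with `X < 0` corresponds to
`a = 4 - 7488 / X` and `x - y = Y / (12 * (X - 1664))`. The scaling makes the model integral. -/
def ninePeriodCurve : WeierstrassCurve ℤ :=
  ⟨0, 2121, 0, -14406912, 13182713856⟩

instance : ninePeriodCurve.IsCharNeTwoNF := ⟨rfl, rfl⟩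

instance (K : Type*) [Field K] [CharZero K] : (ninePeriodCurve⁄K).IsElliptic := by
  have hΔ : ninePeriodCurve.Δ ≠ 0 := by decide
  refine ⟨isUnit_iff_ne_zero.2 ?_⟩
  exact (WeierstrassCurve.map_Δ ..).trans_ne (Int.cast_ne_zero.2 hΔ)

lemma weierstrassCubic_ninePeriodCurve {K : Type*} [Field K] (x : K) :
    weierstrassCubic (ninePeriodCurve⁄K) x =
      x ^ 3 + 2121 * x ^ 2 - 14406912 * x + 13182713856 := by
  simp [weierstrassCubic, ninePeriodCurve, sub_eq_add_neg]

lemma mem_xCoords_ninePeriodCurve_iff {x : ℚ} :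
    x ∈ xCoords (Set.univ : Set (ninePeriodCurve⁄ℚ).Point) ↔
      ∃ y, y ^ 2 = x ^ 3 + 2121 * x ^ 2 - 14406912 * x + 13182713856 := by
  simp_rw [← weierstrassCubic_ninePeriodCurve, ← equation_iff_sq_eq_weierstrassCubic]
  simp [xCoords, WeierstrassCurve.Affine.equation_iff_nonsingular]

instance : Infinite (ninePeriodCurve⁄ℚ).Point := by
  have heq : (ninePeriodCurve⁄ℚ).toAffine.Equation (67093 / 36) (2840201 / 216) := by
    rw [equation_iff_sq_eq_weierstrassCubic, weierstrassCubic_ninePeriodCurve]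
    norm_num
  have hint (n : ℤ) : (n : ℚ) ∈ (Rat.padicValuation 2).integer := intCast_mem _ n
  refine infinite_point_of_one_lt_valuation (v := Rat.padicValuation 2) two_ne_zero ?_
    (hint 2121) (hint (-14406912)) (hint 13182713856)
    (WeierstrassCurve.Affine.equation_iff_nonsingular.1 heq) ?_
  · exact Int.padicValuation_lt_one_iff.2 (dvd_refl 2)
  · rw [← not_le, Rat.padicValuation_le_one_iff]
    norm_num

/-- The parameter of the Lyness recurrence attached to the abscissa `x` on `ninePeriodCurve`; it is
meaningful only for `x ≠ 0`, the division giving the junk value `4` at `x = 0`. -/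
def lynessParam {K : Type*} [Field K] (x : K) : K := 4 - 7488 / x

/-- The cubic whose sign at `a > 4` is that of the discriminant of the quadratic equation for the
initial conditions `x₀, x₁` with `x₀ + x₁ = 23 / 4` that are `9`-periodic for the parameter `a`. -/
def thresholdCubic {K : Type*} [Field K] (t : K) : K :=
  t ^ 3 - 2019 / 529 * t ^ 2 - 777 / 92 * t - 1

lemma weierstrassCubic_ninePeriodCurve_eq_thresholdCubic {K : Type*} [Field K] [CharZero K]
    {x : K} (hx : x ≠ 0) :
    weierstrassCubic (ninePeriodCurve⁄K) x =
      529 / 16848 * (-x) ^ 3 * thresholdCubic (lynessParam x) := by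
  rw [weierstrassCubic_ninePeriodCurve, thresholdCubic, lynessParam]
  field_simp
  ring

lemma lynessParam_mem_lynessNinePeriodicParams {x : ℚ} (hx : x < 0)
    (h : x ∈ xCoords (Set.univ : Set (ninePeriodCurve⁄ℚ).Point)) :
    lynessParam x ∈ lynessNinePeriodicParams := by
  obtain ⟨y, hy⟩ := mem_xCoords_ninePeriodCurve_iff.1 h
  have ha : 4 < lynessParam x := by
    have := div_neg_of_pos_of_neg (show (0 : ℚ) < 7488 by norm_num) hx
    rw [lynessParam]
    linarith
  have hx₀ : x ≠ 0 := hx.ne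
  have hx₁ : x - 1664 ≠ 0 := by linarith
  refine mem_lynessNinePeriodicParams (x := (23 / 4 + y / (12 * (x - 1664))) / 2)
    (y := (23 / 4 - y / (12 * (x - 1664))) / 2) ha (by ring) ?_
  have hprod : (23 / 4 + y / (12 * (x - 1664))) / 2 * ((23 / 4 - y / (12 * (x - 1664))) / 2) =
      (529 / 16 - y ^ 2 / (144 * (x - 1664) ^ 2)) / 4 := by
    field_simp
    ring
  rw [hprod, hy, lynessParam]
  field_simp
  ring

lemma monotoneOn_lynessParam {K : Type*} [Field K] [LinearOrder K] [IsStrictOrderedRing K] :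
    MonotoneOn (lynessParam : K → K) (Set.Iio 0) := fun x _ z hz hxz => by
  rw [lynessParam, lynessParam, div_eq_mul_one_div 7488 z, div_eq_mul_one_div 7488 x]
  gcongr 4 - 7488 * ?_
  exact one_div_le_one_div_of_neg_of_le hz hxz

lemma mem_closure_rat_xCoords_ninePeriodCurve {x : ℝ} (hx : x < 0)
    (hpos : ∀ t, lynessParam x ≤ t → 0 < thresholdCubic t) :
    x ∈ closure (((↑) : ℚ → ℝ) '' xCoords (Set.univ : Set (ninePeriodCurve⁄ℚ).Point)) := by
  have hzero : (0 : ℚ) ∈ xCoords (Set.univ : Set (ninePeriodCurve⁄ℚ).Point) :=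
    mem_xCoords_ninePeriodCurve_iff.2 ⟨114816, by norm_num⟩
  refine Icc_subset_closure_rat_xCoords hzero (fun z ⟨hxz, hz⟩ => ?_)
    (Set.left_mem_Icc.2 (by simpa using hx.le))
  rw [Rat.cast_zero] at hz
  rcases hz.lt_or_eq with hz | rfl
  · rw [weierstrassCubic_ninePeriodCurve_eq_thresholdCubic hz.ne]
    have := hpos _ (monotoneOn_lynessParam hx hz hxz)
    have := neg_pos.2 hz
    positivity
  · norm_num [weierstrassCubic_ninePeriodCurve]

lemma mem_closure_lynessNinePeriodicParams {a : ℝ} (ha : 4 < a)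
    (hpos : ∀ t, a ≤ t → 0 < thresholdCubic t) :
    a ∈ closure ((fun q : ℚ => (q : ℝ)) '' lynessNinePeriodicParams) := by
  have hx : -7488 / (a - 4) < 0 := div_neg_of_neg_of_pos (by norm_num) (by linarith)
  have hax : lynessParam (-7488 / (a - 4)) = a := by
    rw [lynessParam]
    field_simp [sub_ne_zero.2 ha.ne']
    ring
  have hcont : ContinuousAt lynessParam (-7488 / (a - 4)) :=
    continuousAt_const.sub (continuousAt_const.div continuousAt_id hx.ne)
  have hmem := hcont.continuousWithinAt.mem_closure_image (isOpen_Iio.inter_closure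
    ⟨hx, mem_closure_rat_xCoords_ninePeriodCurve hx (by rwa [hax])⟩)
  rw [hax] at hmem
  refine closure_mono ?_ hmem
  rintro _ ⟨_, ⟨hneg, x, hx, rfl⟩, rfl⟩
  have hneg' : x < 0 := Rat.cast_lt_zero.1 (Set.mem_Iio.1 hneg)
  exact ⟨_, lynessParam_mem_lynessNinePeriodicParams hneg' hx, by simp [lynessParam]⟩

end NinePeriodCurve

lemma exists_thresholdCubic_eq_zero_forall_lt_pos :
    ∃ a₁ : ℝ, thresholdCubic a₁ = 0 ∧ |a₁ - 5.41147624| < 5e-9 ∧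
      ∀ t, a₁ < t → 0 < thresholdCubic t := by
  have hcont : Continuous (thresholdCubic : ℝ → ℝ) := by
    unfold thresholdCubic
    fun_prop
  obtain ⟨a₁, ⟨hl, hr⟩, hroot⟩ := intermediate_value_Icc
    (show (5.41147624 - 4e-9 : ℝ) ≤ 5.41147624 + 4e-9 by norm_num) hcont.continuousOn
    (show (0 : ℝ) ∈ _ by norm_num [thresholdCubic])
  refine ⟨a₁, hroot, abs_lt.2 ⟨by linarith, by linarith⟩, fun t ht => ?_⟩
  have ha₁ : 5 < a₁ := by linarith
  have hq : 0 < t ^ 2 + t * a₁ + a₁ ^ 2 - 2019 / 529 * (t + a₁) - 777 / 92 := by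
    nlinarith [mul_pos (sub_pos.2 (ha₁.trans ht)) (sub_pos.2 ha₁)]
  have hfactor : thresholdCubic t - thresholdCubic a₁ =
      (t - a₁) * (t ^ 2 + t * a₁ + a₁ ^ 2 - 2019 / 529 * (t + a₁) - 777 / 92) := by
    rw [thresholdCubic, thresholdCubic]
    ring
  rw [hroot, sub_zero] at hfactor
  exact hfactor ▸ mul_pos (sub_pos.2 ht) hq

theorem theorem2 :
    lynessNinePeriodicParams.Infinite ∧
    ∃ a₁ : ℝ,
      IsGreatest {t : ℝ | t ^ 3 - 2019 / 529 * t ^ 2 - 777 / 92 * t - 1 = 0} a₁ ∧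
      |a₁ - 5.41147624| < 5e-9 ∧
      Set.Ici a₁ ⊆ closure ((fun q : ℚ => (q : ℝ)) '' lynessNinePeriodicParams) := by
  obtain ⟨a₁, hroot, happrox, hpos⟩ := exists_thresholdCubic_eq_zero_forall_lt_pos
  have h4 : 4 < a₁ := by linarith [(abs_lt.1 happrox).1]
  have hsub : Set.Ici a₁ ⊆ closure ((fun q : ℚ => (q : ℝ)) '' lynessNinePeriodicParams) := by
    rw [← closure_Ioi]
    refine closure_minimal (fun a (ha : a₁ < a) => ?_) isClosed_closure
    exact mem_closure_lynessNinePeriodicParams (h4.trans ha) fun t ht => hpos t (ha.trans_le ht)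
  refine ⟨fun hfin => ?_, a₁, ⟨hroot, fun t ht => ?_⟩, happrox, hsub⟩
  · have hfin' := hfin.image fun q : ℚ => (q : ℝ)
    rw [hfin'.isClosed.closure_eq] at hsub
    exact Set.Ici_infinite a₁ (hfin'.subset hsub)
  · by_contra! hlt
    exact (hpos t hlt).ne' ht
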